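/- Let $\Sigma$ be a finite alphabet. A subset of $\mathbb{N}^n$ is \emph{linear} if it has the form $\bar c + P^*$ with $\bar c \in \mathbb{N}^n$ and $P \subseteq \mathbb{N}^n$ finite, where $P^*$ is the submonoid of $(\mathbb{N}^n,+)$ generated by $P$; it is \emph{semilinear} if it is a finite union of linear sets. A \emph{socle} of a language $L \subseteq \Sigma^*$ is a sequence of nonempty words $w_1, \ldots, w_n \in \Sigma^+$, with $n > 0$, such that $L \subseteq w_1^* w_2^* \cdots w_n^*$. Let $\mathrm{BSL}$ be the class of \emph{bounded semilinear languages} over $\Sigma$, that is, of the languages $L \subseteq \Sigma^*$ which have a socle $w_1, \ldots, w_n$ such that the iteration set $\{(i_1, \ldots, i_n) \in \mathbb{N}^n \mid w_1^{i_1} \cdots w_n^{i_n} \in L\}$ is semilinear. Proposition. The class $\mathrm{BSL}$ is closed under union, intersection and concatenation: if $L_1, L_2 \in \mathrm{BSL}$, then $L_1 \cup L_2 \in \mathrm{BSL}$, $L_1 \cap L_2 \in \mathrm{BSL}$ and $L_1 L_2 \in \mathrm{BSL}$. -/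

import Mathlib

open scoped Computability

namespace BoundedSemilinear

/-- The word `w₁^{i₁} ⋯ wₙ^{iₙ}`. -/
def powerWord {α : Type*} {n : ℕ} (w : Fin n → List α) (i : Fin n → ℕ) : List α :=
  (List.ofFn fun k => (List.replicate (i k) (w k)).flatten).flatten

/-- The language `w₁* w₂* ⋯ wₙ*`. -/
def starProduct {α : Type*} {n : ℕ} (w : Fin n → List α) : Language α :=
  (List.ofFn fun k => ({w k} : Language α)∗).prod

/-- `w₁, …, wₙ` is a socle of `L`: `n > 0`, every `wₖ` is a nonempty word,
and `L ⊆ w₁* ⋯ wₙ*`. -/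
structure IsSocle {α : Type*} {n : ℕ} (w : Fin n → List α) (L : Language α) : Prop where
  pos : 0 < n
  ne_nil : ∀ k, w k ≠ []
  le_starProduct : L ≤ starProduct w

/-- The iteration set `{(i₁, …, iₙ) ∈ ℕⁿ | w₁^{i₁} ⋯ wₙ^{iₙ} ∈ L}` of `L` with respect to
`w₁, …, wₙ`. -/
def iterationSet {α : Type*} {n : ℕ} (w : Fin n → List α) (L : Language α) :
    Set (Fin n → ℕ) :=
  {i | powerWord w i ∈ L}

/-- The class of bounded semilinear languages over the alphabet `α`: the languages that have a
socle with respect to which their iteration set is semilinear. -/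
def BSL (α : Type*) : Set (Language α) :=
  {L | ∃ (n : ℕ) (w : Fin n → List α), IsSocle w L ∧ IsSemilinearSet (iterationSet w L)}

end BoundedSemilinear

namespace BoundedSemilinear

open Set AddSubmonoid
open scoped Pointwise

/-! ### Weights of paths in a graph -/

section Path

variable {Q M : Type*} [AddCommMonoid M] {E : Q → M → Q → Prop} {S T : Set Q} {p q r : Q}
  {x y : M}

/-- `WeightedPath E S p x q`: the graph with weighted edges `E` has a nonempty path of total
weight `x` from `p` to `q`, all of whose intermediate vertices lie in `S`. -/
inductive WeightedPath (E : Q → M → Q → Prop) (S : Set Q) : Q → M → Q → Prop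
  | edge {p q : Q} {x : M} : E p x q → WeightedPath E S p x q
  | cons {p r q : Q} {x y : M} : E p x r → r ∈ S → WeightedPath E S r y q →
      WeightedPath E S p (x + y) q

theorem WeightedPath.mono (hST : S ⊆ T) (h : WeightedPath E S p x q) : WeightedPath E T p x q := by
  induction h with
  | edge h => exact .edge h
  | cons h hr _ ih => exact .cons h (hST hr) ih

theorem WeightedPath.trans (h₁ : WeightedPath E S p x r) (hr : r ∈ S)
    (h₂ : WeightedPath E S r y q) : WeightedPath E S p (x + y) q := by
  induction h₁ with
  | edge h => exact .cons h hr h₂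
  | cons h hr' _ ih => rw [add_assoc]; exact .cons h hr' (ih hr h₂)

theorem setOf_weightedPath_empty : {x | WeightedPath E ∅ p x q} = {x | E p x q} := by
  ext x
  refine ⟨fun h => ?_, .edge⟩
  cases h with
  | edge h => exact h
  | cons _ h _ => exact h.elim

theorem setOf_weightedPath_insert :
    {x | WeightedPath E (insert r S) p x q} = {x | WeightedPath E S p x q} ∪
      ({x | WeightedPath E S p x r} + (closure {x | WeightedPath E S r x r} : Set M) +
        {x | WeightedPath E S r x q}) := by
  have hS : S ⊆ insert r S := subset_insert r S
  ext x
  constructor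
  · intro h
    change WeightedPath E (insert r S) p x q at h
    induction h with
    | edge h => exact .inl (.edge h)
    | @cons p r' q x y h hr h' ih =>
      rcases eq_or_ne r' r with rfl | hne
      · right
        rcases ih with ih | ⟨_, ⟨a, ha, c, hc, rfl⟩, b, hb, rfl⟩
        · exact ⟨x + 0, ⟨x, .edge h, 0, zero_mem _, rfl⟩, y, ih, by simp⟩
        · exact ⟨x + (a + c), ⟨x, .edge h, a + c, add_mem (subset_closure ha) hc, rfl⟩, b, hb,
            add_assoc _ _ _⟩
      · have hr' : r' ∈ S := hr.resolve_left hne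
        rcases ih with ih | ⟨_, ⟨a, ha, c, hc, rfl⟩, b, hb, rfl⟩
        · exact .inl (.cons h hr' ih)
        · exact .inr ⟨x + a + c, ⟨x + a, .cons h hr' ha, c, hc, rfl⟩, b, hb, by
            simp only [add_assoc]⟩
  · rintro (h | ⟨_, ⟨a, ha, c, hc, rfl⟩, b, hb, rfl⟩)
    · exact h.mono hS
    · have key : ∀ y, WeightedPath E (insert r S) r y q →
          WeightedPath E (insert r S) r (c + y) q := by
        induction hc using closure_induction with
        | mem c hc => exact fun y hy => (WeightedPath.mono hS hc).trans (mem_insert r S) hy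
        | zero => simp
        | add c d _ _ ihc ihd => exact fun y hy => by rw [add_assoc]; exact ihc _ (ihd _ hy)
      change WeightedPath E _ _ (a + c + b) _
      rw [add_assoc]
      exact (WeightedPath.mono hS ha).trans (mem_insert r S) (key b (WeightedPath.mono hS hb))

theorem isSemilinearSet_weightedPath (hE : ∀ p q, IsSemilinearSet {x | E p x q}) (hS : S.Finite)
    (p q : Q) : IsSemilinearSet {x | WeightedPath E S p x q} := by
  induction S, hS using Finite.induction_on generalizing p q with
  | empty => simpa only [setOf_weightedPath_empty] using hE p q
  | insert _ _ ih =>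
    rw [setOf_weightedPath_insert]
    exact (ih _ _).union (((ih _ _).add (ih _ _).closure).add (ih _ _))

end Path

/-! ### Synchronizing two sequences of weighted words -/

section Sync

variable {α M : Type*} [AddCommMonoid M]

/-- `Expands l k z m`: the word `z` arises by repeating each word of `l` some number of times,
in order, in `k` elementary steps; `m` is the sum of the weights of the words used. -/
inductive Expands : List (List α × M) → ℕ → List α → M → Prop
  | nil : Expands [] 0 [] 0
  | drop {p l k z m} : Expands l k z m → Expands (p :: l) (k + 1) z m
  | use {p l k z m} : Expands (p :: l) k z m → Expands (p :: l) (k + 1) (p.1 ++ z) (p.2 + m)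

/-- A state of the automaton that expands two sequences of weighted words in parallel: for each
side, the part of the current word still to be read, and the sequence still to be expanded. -/
abbrev SyncState (α M : Type*) : Type _ :=
  (List α × List (List α × M)) × (List α × List (List α × M))

/-- The transitions of the automaton that expands two sequences of weighted words in parallel. -/
inductive SyncStep : SyncState α M → M → SyncState α M → Prop
  | final : SyncStep (([], []), ([], [])) 0 (([], []), ([], []))
  | read {a t s l r} : SyncStep ((a :: t, l), (a :: s, r)) 0 ((t, l), (s, r))
  | dropLeft {p t l s} : SyncStep ((t, p :: l), s) 0 ((t, l), s)
  | useLeft {p l s} : SyncStep (([], p :: l), s) p.2 ((p.1, p :: l), s)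
  | dropRight {p t r s} : SyncStep (s, (t, p :: r)) 0 (s, (t, r))
  | useRight {p r s} : SyncStep (s, ([], p :: r)) p.2 (s, (p.1, p :: r))

theorem isSemilinearSet_syncStep (σ τ : SyncState α M) :
    IsSemilinearSet {x | SyncStep σ x τ} := by
  refine .of_finite (Set.Finite.subset
    (s := {0} ∪ Prod.snd '' {p | p ∈ σ.1.2} ∪ Prod.snd '' {p | p ∈ σ.2.2}) ?_ ?_)
  · exact ((finite_singleton 0).union (σ.1.2.finite_toSet.image _)).union
      (σ.2.2.finite_toSet.image _)
  · intro x hx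
    cases hx with
    | useLeft => exact .inl (.inr ⟨_, List.mem_cons_self, rfl⟩)
    | useRight => exact .inr ⟨_, List.mem_cons_self, rfl⟩
    | _ => exact .inl (.inl rfl)

/-- The two sides of the state `σ` expand to a common word with total weight `x`. -/
def Syncs (σ : SyncState α M) (x : M) : Prop :=
  ∃ k k' z z' m m', Expands σ.1.2 k z m ∧ Expands σ.2.2 k' z' m' ∧ σ.1.1 ++ z = σ.2.1 ++ z' ∧
    m + m' = x

theorem SyncStep.syncs {σ τ : SyncState α M} {x y : M} (h : SyncStep σ x τ) (hτ : Syncs τ y) :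
    Syncs σ (x + y) := by
  obtain ⟨k, k', z, z', m, m', h₁, h₂, hz, rfl⟩ := hτ
  cases h with
  | final => exact ⟨k, k', z, z', m, m', h₁, h₂, hz, by simp⟩
  | read => exact ⟨k, k', z, z', m, m', h₁, h₂, by simpa using hz, by simp⟩
  | dropLeft => exact ⟨_, k', z, z', m, m', h₁.drop, h₂, hz, by simp⟩
  | useLeft => exact ⟨_, k', _, z', _, m', h₁.use, h₂, by simpa using hz, by simp [add_assoc]⟩
  | dropRight => exact ⟨k, _, z, z', m, m', h₁, h₂.drop, hz, by simp⟩
  | useRight =>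
    exact ⟨k, _, z, _, m, _, h₁, h₂.use, by simpa using hz, add_left_comm _ _ _⟩

theorem syncs_nil : Syncs ((([], []), ([], [])) : SyncState α M) 0 :=
  ⟨0, 0, [], [], 0, 0, .nil, .nil, rfl, by simp⟩

theorem syncs_of_weightedPath {S : Set (SyncState α M)} {σ τ : SyncState α M} {x : M}
    (h : WeightedPath SyncStep S σ x τ) (hτ : τ = (([], []), ([], []))) : Syncs σ x := by
  induction h with
  | edge h => subst hτ; simpa using h.syncs syncs_nil
  | cons h _ _ ih => exact h.syncs (ih hτ)

/-- The states that can occur when the sequences `l` and `r`, whose words have length at most `N`,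
are expanded in parallel. -/
def syncStates (N : ℕ) (l r : List (List α × M)) : Set (SyncState α M) :=
  ({t | t.length ≤ N} ×ˢ {l' | l' <:+ l}) ×ˢ ({t | t.length ≤ N} ×ˢ {r' | r' <:+ r})

omit [AddCommMonoid M] in
theorem mem_syncStates {N : ℕ} {l r l' r' : List (List α × M)} {t s : List α} :
    ((t, l'), (s, r')) ∈ syncStates N l r ↔
      (t.length ≤ N ∧ l' <:+ l) ∧ s.length ≤ N ∧ r' <:+ r :=
  Iff.rfl

omit [AddCommMonoid M] in
theorem finite_syncStates [Finite α] (N : ℕ) (l r : List (List α × M)) :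
    (syncStates N l r).Finite := by
  have hs (l : List (List α × M)) : {l' | l' <:+ l}.Finite :=
    l.tails.finite_toSet.subset fun l' h => (List.mem_tails _ _).2 h
  exact ((List.finite_length_le α N).prod (hs l)).prod ((List.finite_length_le α N).prod (hs r))

theorem weightedPath_of_syncs {N : ℕ} {l r : List (List α × M)}
    (hl : ∀ p ∈ l, p.1.length ≤ N) (hr : ∀ p ∈ r, p.1.length ≤ N) {σ : SyncState α M} {x : M}
    (hσ : σ ∈ syncStates N l r) (h : Syncs σ x) :
    WeightedPath SyncStep (syncStates N l r) σ x (([], []), ([], [])) := by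
  obtain ⟨k, k', z, z', m, m', h₁, h₂, hz, rfl⟩ := h
  induction hn : (σ.1.1 ++ z).length + k + k' using Nat.strong_induction_on
    generalizing σ k k' z z' m m' with | _ n ih
  subst hn
  have step {τ : SyncState α M} {y b b' : M} {j j' : ℕ} {a a' : List α} (e : SyncStep σ y τ)
      (hτ : τ ∈ syncStates N l r) (h₁ : Expands τ.1.2 j a b) (h₂ : Expands τ.2.2 j' a' b')
      (ha : τ.1.1 ++ a = τ.2.1 ++ a')
      (hlt : (τ.1.1 ++ a).length + j + j' < (σ.1.1 ++ z).length + k + k')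
      (hw : y + (b + b') = m + m') :
      WeightedPath SyncStep (syncStates N l r) σ (m + m') (([], []), ([], [])) :=
    hw ▸ .cons e hτ (ih _ hlt hτ _ _ _ _ _ _ h₁ h₂ ha rfl)
  clear ih
  obtain ⟨⟨t, l'⟩, ⟨s, r'⟩⟩ := σ
  obtain ⟨⟨ht, hl'⟩, hs, hr'⟩ := mem_syncStates.1 hσ
  clear hσ
  dsimp only at h₁ h₂ hz step
  cases t with
  | nil =>
    cases h₁ with
    | drop h₁ =>
      exact step .dropLeft ⟨⟨ht, (List.suffix_cons _ _).trans hl'⟩, hs, hr'⟩ h₁ h₂ hz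
        (by dsimp only; omega) (zero_add _)
    | use h₁ =>
      exact step .useLeft ⟨⟨hl _ (hl'.subset List.mem_cons_self), hl'⟩, hs, hr'⟩ h₁ h₂
        (by simpa using hz) (by simp) (add_assoc _ _ _).symm
    | nil =>
      obtain rfl : s = [] := (List.append_eq_nil_iff.1 hz.symm).1
      cases h₂ with
      | nil => simpa using WeightedPath.edge .final
      | drop h₂ =>
        exact step .dropRight ⟨⟨ht, hl'⟩, hs, (List.suffix_cons _ _).trans hr'⟩ .nil h₂ hz
          (by dsimp only; omega) (zero_add _)
      | use h₂ =>
        exact step .useRight ⟨⟨ht, hl'⟩, hr _ (hr'.subset List.mem_cons_self), hr'⟩ .nil h₂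
          (by simpa using hz) (by dsimp only; omega) (add_left_comm _ _ _)
  | cons a t =>
    cases s with
    | cons b s =>
      obtain ⟨rfl, hz'⟩ := List.cons.inj hz
      exact step .read ⟨⟨(Nat.le_succ _).trans ht, hl'⟩, (Nat.le_succ _).trans hs, hr'⟩ h₁ h₂ hz'
        (by simp) (zero_add _)
    | nil =>
      cases h₂ with
      | nil => simp at hz
      | drop h₂ =>
        exact step .dropRight ⟨⟨ht, hl'⟩, hs, (List.suffix_cons _ _).trans hr'⟩ h₁ h₂ hz
          (by dsimp only; omega) (zero_add _)
      | use h₂ =>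
        exact step .useRight ⟨⟨ht, hl'⟩, hr _ (hr'.subset List.mem_cons_self), hr'⟩ h₁ h₂
          (by simpa using hz) (by dsimp only; omega) (add_left_comm _ _ _)

theorem isSemilinearSet_syncs [Finite α] (l r : List (List α × M)) :
    IsSemilinearSet {x | Syncs (([], l), ([], r)) x} := by
  obtain ⟨N, hN⟩ : ∃ N, ∀ p ∈ l ++ r, p.1.length ≤ N :=
    ((l ++ r).finite_toSet.image fun p => p.1.length).bddAbove.imp
      fun N hN p hp => hN (mem_image_of_mem _ hp)
  convert! isSemilinearSet_weightedPath isSemilinearSet_syncStep (finite_syncStates N l r)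
    (([], l), ([], r)) (([], []), ([], [])) using 1
  ext x
  exact ⟨weightedPath_of_syncs (fun p hp => hN p (List.mem_append_left _ hp))
    (fun p hp => hN p (List.mem_append_right _ hp))
    ⟨⟨Nat.zero_le _, List.suffix_rfl⟩, Nat.zero_le _, List.suffix_rfl⟩,
    fun h => syncs_of_weightedPath h rfl⟩

end Sync

/-! ### Iteration sets -/

section PowerWord

variable {α M : Type*} {m n : ℕ}

theorem powerWord_succ (w : Fin (n + 1) → List α) (i : Fin (n + 1) → ℕ) :
    powerWord w i = (List.replicate (i 0) (w 0)).flatten ++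
      powerWord (fun k => w k.succ) fun k => i k.succ := by
  simp [powerWord, List.ofFn_succ]

theorem powerWord_append (u : Fin m → List α) (v : Fin n → List α) (i : Fin (m + n) → ℕ) :
    powerWord (Fin.append u v) i =
      powerWord u (i ∘ Fin.castAdd n) ++ powerWord v (i ∘ Fin.natAdd m) := by
  have h : (fun k => (List.replicate (i k) (Fin.append u v k)).flatten) =
      Fin.append (fun k => (List.replicate (i (Fin.castAdd n k)) (u k)).flatten)
        fun k => (List.replicate (i (Fin.natAdd m k)) (v k)).flatten := by
    ext1 k
    refine Fin.addCases (fun k => ?_) (fun k => ?_) k <;> simp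
  simp only [powerWord, h, List.ofFn_fin_append, List.flatten_append, Function.comp_apply]

theorem powerWord_zero (w : Fin n → List α) : powerWord w 0 = [] := by
  simp [powerWord]

theorem mem_starProduct {w : Fin n → List α} {x : List α} :
    x ∈ starProduct w ↔ ∃ i, powerWord w i = x := by
  induction n generalizing x with
  | zero => simp [starProduct, powerWord, eq_comm]
  | succ n ih =>
    have h : starProduct w = ({w 0} : Language α)∗ * starProduct fun k => w k.succ := by
      simp [starProduct, List.ofFn_succ]
    simp only [h, Language.mem_mul, Language.mem_kstar, ih]
    constructor
    · rintro ⟨_, ⟨L, rfl, hL⟩, _, ⟨i, rfl⟩, rfl⟩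
      refine ⟨Fin.cons L.length i, ?_⟩
      rw [powerWord_succ]
      simp [← List.eq_replicate_of_mem hL]
    · rintro ⟨i, rfl⟩
      exact ⟨_, ⟨_, rfl, fun y hy => List.eq_of_mem_replicate hy⟩, _, ⟨_, rfl⟩,
        (powerWord_succ w i).symm⟩

variable [AddCommMonoid M]

theorem exists_expands_cons {p : List α × M} {l : List (List α × M)} {z : List α} {x : M} :
    (∃ k, Expands (p :: l) k z x) ↔
      ∃ c k z' x', Expands l k z' x' ∧ z = (List.replicate c p.1).flatten ++ z' ∧
        x = c • p.2 + x' := by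
  constructor
  · rintro ⟨k, h⟩
    generalize hl : p :: l = l' at h
    induction h with
    | nil => cases hl
    | drop h _ => cases hl; exact ⟨0, _, _, _, h, by simp, by simp⟩
    | use h ih =>
      cases hl
      obtain ⟨c, k, z', x', h', rfl, rfl⟩ := ih rfl
      exact ⟨c + 1, k, z', x', h', by simp [List.replicate_succ],
        by rw [succ_nsmul', add_assoc]⟩
  · rintro ⟨c, k, z', x', h, rfl, rfl⟩
    induction c with
    | zero => exact ⟨k + 1, by simpa using h.drop⟩
    | succ c ih =>
      obtain ⟨k, hk⟩ := ih
      exact ⟨k + 1, by simpa [List.replicate_succ, succ_nsmul', add_assoc] using hk.use⟩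

theorem exists_expands_ofFn {w : Fin n → List α} {f : Fin n → M} {z : List α} {x : M} :
    (∃ k, Expands (List.ofFn fun j => (w j, f j)) k z x) ↔
      ∃ i, powerWord w i = z ∧ ∑ j, i j • f j = x := by
  induction n generalizing z x with
  | zero =>
    simp only [List.ofFn_zero, powerWord, Finset.univ_eq_empty, Finset.sum_empty]
    constructor
    · rintro ⟨k, h⟩
      cases h
      exact ⟨0, rfl, rfl⟩
    · rintro ⟨i, rfl, rfl⟩
      exact ⟨0, .nil⟩
  | succ n ih =>
    rw [List.ofFn_succ, exists_expands_cons]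
    constructor
    · rintro ⟨c, k, z', x', h, rfl, rfl⟩
      obtain ⟨i, rfl, rfl⟩ := ih.1 ⟨k, h⟩
      exact ⟨Fin.cons c i, by simp [powerWord_succ], by simp [Fin.sum_univ_succ]⟩
    · rintro ⟨i, rfl, rfl⟩
      obtain ⟨k, h⟩ := ih.2 ⟨fun j => i j.succ, rfl, rfl⟩
      exact ⟨i 0, k, _, _, h, powerWord_succ w i, Fin.sum_univ_succ _⟩

theorem isSemilinearSet_powerWord_eq [Finite α] (u : Fin m → List α) (v : Fin n → List α) :
    IsSemilinearSet {x : Fin m ⊕ Fin n → ℕ |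
      powerWord u (x ∘ Sum.inl) = powerWord v (x ∘ Sum.inr)} := by
  let e (k : Fin m ⊕ Fin n) : Fin m ⊕ Fin n → ℕ := Pi.single k 1
  have he (i : Fin m → ℕ) (j : Fin n → ℕ) :
      ∑ k, i k • e (Sum.inl k) + ∑ k, j k • e (Sum.inr k) = Sum.elim i j := by
    rw [pi_eq_sum_univ' (Sum.elim i j), Fintype.sum_sum_type]
    rfl
  convert! isSemilinearSet_syncs (List.ofFn fun k => (u k, e (Sum.inl k)))
    (List.ofFn fun k => (v k, e (Sum.inr k))) using 1
  ext x
  constructor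
  · intro h
    obtain ⟨k, hk⟩ := exists_expands_ofFn (f := e ∘ Sum.inl).2 ⟨x ∘ Sum.inl, h, rfl⟩
    obtain ⟨k', hk'⟩ := exists_expands_ofFn (f := e ∘ Sum.inr).2 ⟨x ∘ Sum.inr, rfl, rfl⟩
    exact ⟨k, k', _, _, _, _, hk, hk', rfl, (he _ _).trans (Sum.elim_comp_inl_inr x)⟩
  · rintro ⟨k, k', z, z', _, _, hk, hk', hz, rfl⟩
    obtain ⟨i, rfl, rfl⟩ := exists_expands_ofFn.1 ⟨k, hk⟩
    obtain ⟨j, rfl, rfl⟩ := exists_expands_ofFn.1 ⟨k', hk'⟩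
    rw [he]
    exact hz

theorem isSemilinearSet_exists_powerWord_eq [Finite α] (u : Fin m → List α)
    (v : Fin n → List α) {S : Set (Fin n → ℕ)} (hS : IsSemilinearSet S) :
    IsSemilinearSet {i | ∃ j ∈ S, powerWord u i = powerWord v j} := by
  refine IsSemilinearSet.proj' (p := fun i j => j ∈ S ∧ powerWord u i = powerWord v j) ?_
  exact (hS.preimage (LinearMap.funLeft ℕ ℕ Sum.inr)).inter (isSemilinearSet_powerWord_eq u v)

end PowerWord

/-! ### Closure properties of bounded semilinear languages -/

section Closure

variable {α : Type*} {m n : ℕ}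

/-- The bounded semilinear languages are the images of semilinear sets under the maps
`i ↦ w₁^{i₁} ⋯ wₙ^{iₙ}`. -/
theorem mem_BSL_iff [Finite α] {L : Language α} :
    L ∈ BSL α ↔ ∃ (n : ℕ) (w : Fin n → List α) (S : Set (Fin n → ℕ)), 0 < n ∧
      (∀ k, w k ≠ []) ∧ IsSemilinearSet S ∧ ∀ x, x ∈ L ↔ ∃ i ∈ S, powerWord w i = x := by
  constructor
  · rintro ⟨n, w, hw, hS⟩
    refine ⟨n, w, _, hw.pos, hw.ne_nil, hS, fun x => ⟨fun hx => ?_, ?_⟩⟩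
    · obtain ⟨i, rfl⟩ := mem_starProduct.1 (hw.le_starProduct hx)
      exact ⟨i, hx, rfl⟩
    · rintro ⟨i, hi, rfl⟩
      exact hi
  · rintro ⟨n, w, S, hn, hw, hS, hL⟩
    refine ⟨n, w, ⟨hn, hw, fun x hx => ?_⟩, ?_⟩
    · obtain ⟨i, -, rfl⟩ := (hL x).1 hx
      exact mem_starProduct.2 ⟨i, rfl⟩
    · convert! isSemilinearSet_exists_powerWord_eq w w hS using 1
      ext i
      exact (hL _).trans (by simp only [mem_ofPred_eq, eq_comm])

theorem append_ne_nil {u : Fin m → List α} {v : Fin n → List α} (hu : ∀ k, u k ≠ [])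
    (hv : ∀ k, v k ≠ []) (k : Fin (m + n)) : Fin.append u v k ≠ [] := by
  refine Fin.addCases (fun k => ?_) (fun k => ?_) k
  · simpa using hu k
  · simpa using hv k

theorem isSemilinearSet_append {S : Set (Fin m → ℕ)} {T : Set (Fin n → ℕ)}
    (hS : IsSemilinearSet S) (hT : IsSemilinearSet T) :
    IsSemilinearSet {i : Fin (m + n) → ℕ | i ∘ Fin.castAdd n ∈ S ∧ i ∘ Fin.natAdd m ∈ T} :=
  (hS.preimage (LinearMap.funLeft ℕ ℕ (Fin.castAdd n))).inter
    (hT.preimage (LinearMap.funLeft ℕ ℕ (Fin.natAdd m)))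

theorem exists_powerWord_append {u : Fin m → List α} {v : Fin n → List α} {S : Set (Fin m → ℕ)}
    {T : Set (Fin n → ℕ)} {x : List α} :
    (∃ i ∈ {i : Fin (m + n) → ℕ | i ∘ Fin.castAdd n ∈ S ∧ i ∘ Fin.natAdd m ∈ T},
      powerWord (Fin.append u v) i = x) ↔
      ∃ i ∈ S, ∃ j ∈ T, powerWord u i ++ powerWord v j = x := by
  constructor
  · rintro ⟨i, ⟨hi, hj⟩, rfl⟩
    exact ⟨_, hi, _, hj, (powerWord_append u v i).symm⟩
  · rintro ⟨i, hi, j, hj, rfl⟩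
    have h₁ : Fin.append i j ∘ Fin.castAdd n = i := by ext k; simp
    have h₂ : Fin.append i j ∘ Fin.natAdd m = j := by ext k; simp
    exact ⟨Fin.append i j, ⟨h₁.symm ▸ hi, h₂.symm ▸ hj⟩, by rw [powerWord_append, h₁, h₂]⟩

variable [Finite α] {L₁ L₂ : Language α}

theorem add_mem_BSL (h₁ : L₁ ∈ BSL α) (h₂ : L₂ ∈ BSL α) : L₁ + L₂ ∈ BSL α := by
  obtain ⟨m, u, S, hm, hu, hS, hL₁⟩ := mem_BSL_iff.1 h₁
  obtain ⟨n, v, T, -, hv, hT, hL₂⟩ := mem_BSL_iff.1 h₂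
  refine mem_BSL_iff.2 ⟨m + n, Fin.append u v, _, by omega, append_ne_nil hu hv,
    (isSemilinearSet_append hS (.singleton 0)).union (isSemilinearSet_append (.singleton 0) hT),
    fun x => ?_⟩
  simp only [mem_union, or_and_right, exists_or, exists_powerWord_append]
  rw [Language.mem_add, hL₁, hL₂]
  simp [powerWord_zero]

theorem inf_mem_BSL (h₁ : L₁ ∈ BSL α) (h₂ : L₂ ∈ BSL α) : L₁ ⊓ L₂ ∈ BSL α := by
  obtain ⟨m, u, S, hm, hu, hS, hL₁⟩ := mem_BSL_iff.1 h₁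
  obtain ⟨n, v, T, -, -, hT, hL₂⟩ := mem_BSL_iff.1 h₂
  refine mem_BSL_iff.2 ⟨m, u, _, hm, hu,
    hS.inter (isSemilinearSet_exists_powerWord_eq u v hT), fun x => ?_⟩
  change x ∈ L₁ ∧ x ∈ L₂ ↔ _
  rw [hL₁, hL₂]
  constructor
  · rintro ⟨⟨i, hi, rfl⟩, j, hj, h⟩
    exact ⟨i, ⟨hi, j, hj, h.symm⟩, rfl⟩
  · rintro ⟨i, ⟨hi, j, hj, h⟩, rfl⟩
    exact ⟨⟨i, hi, rfl⟩, j, hj, h.symm⟩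

theorem mul_mem_BSL (h₁ : L₁ ∈ BSL α) (h₂ : L₂ ∈ BSL α) : L₁ * L₂ ∈ BSL α := by
  obtain ⟨m, u, S, hm, hu, hS, hL₁⟩ := mem_BSL_iff.1 h₁
  obtain ⟨n, v, T, -, hv, hT, hL₂⟩ := mem_BSL_iff.1 h₂
  refine mem_BSL_iff.2 ⟨m + n, Fin.append u v, _, by omega, append_ne_nil hu hv,
    isSemilinearSet_append hS hT, fun x => ?_⟩
  rw [exists_powerWord_append]
  simp [Language.mem_mul, hL₁, hL₂]

end Closure

end BoundedSemilinear

open BoundedSemilinear in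
/-- The class of bounded semilinear languages over a finite alphabet is closed under union,
intersection and concatenation. On `Language α`, `+` is union, `⊓` is intersection and `*` is
concatenation. -/
theorem mainTheorem3 {α : Type*} [Finite α] (L₁ L₂ : Language α)
    (h₁ : L₁ ∈ BSL α) (h₂ : L₂ ∈ BSL α) :
    L₁ + L₂ ∈ BSL α ∧ L₁ ⊓ L₂ ∈ BSL α ∧ L₁ * L₂ ∈ BSL α :=
  ⟨add_mem_BSL h₁ h₂, inf_mem_BSL h₁ h₂, mul_mem_BSL h₁ h₂⟩
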